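/- All vector spaces are over $\mathbb C$. A vertex algebra is a vector space $V$ with a vacuum vector $\mathbf 1$ and a linear map $Y(\cdot,x):V\to\mathrm{Hom}(V,V((x)))$ such that $Y(\mathbf 1,x)=1$, $Y(v,x)\mathbf 1\in V[[x]]$ with constant term $v$, and the Jacobi identity holds. Let $\Gamma$ be a group. A $\Gamma$-vertex algebra is a vertex algebra $V$ with group homomorphisms $R:\Gamma\to \mathrm{GL}(V)$ and $\phi:\Gamma\to\mathbb C^\times$ such that $R_g\mathbf 1=\mathbf 1$ and $R_gY(v,x)R_g^{-1}=Y(R_gv,\phi(g)^{-1}x)$ for $g\in\Gamma$, $v\in V$. A quasimodule for the $\Gamma$-vertex algebra $V$ is a vector space $W$ with a linear map $Y_W:V\to\mathrm{Hom}(W,W((x)))$ such that $Y_W(\mathbf 1,x)=1$, such that $Y_W(R_gv,x)=Y_W(v,\phi(g)x)$ for $g\in\Gamma$, $v\in V$, and such that for all $u,v\in V$: (i) there is a nonzero polynomial $p(x_1,x_2)\in\mathbb C[x_1,x_2]$ with $$x_0^{-1}\delta\Big(\frac{x_1-x_2}{x_0}\Big)p(x_1,x_2)Y_W(u,x_1)Y_W(v,x_2)-x_0^{-1}\delta\Big(\frac{x_2-x_1}{-x_0}\Big)p(x_1,x_2)Y_W(v,x_2)Y_W(u,x_1)=x_2^{-1}\delta\Big(\frac{x_1-x_0}{x_2}\Big)p(x_1,x_2)Y_W(Y(u,x_0)v,x_2);$$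 (ii) there are $\alpha_1,\dots,\alpha_k\in\phi(\Gamma)$ with $(x_1-\alpha_1x_2)\cdots(x_1-\alpha_kx_2)[Y_W(u,x_1),Y_W(v,x_2)]=0$. (The Jacobi identity for $V$ is the identity in (i) with $W=V$, $Y_W=Y$ and $p=1$.) Here $\delta(z)=\sum_{n\in\mathbb Z}z^n$, powers of a binomial are expanded in nonnegative powers of its second term, and $\mathrm{Res}_{x_0}$ denotes the coefficient of $x_0^{-1}$. **Proposition 2.13.** Let $V$ be a $\Gamma$-vertex algebra, let $(W,Y_W)$ be a quasimodule for it, and let $\psi:\phi(\Gamma)\to\Gamma$ be any section of $\phi$, that is, any map with $\phi(\psi(\alpha))=\alpha$ for all $\alpha\in\phi(\Gamma)$. Then for all $u,v\in V$, $$[Y_W(u,x_1),Y_W(v,x_2)]=\sum_{\alpha\in\phi(\Gamma)}\mathrm{Res}_{x_0}\,x_1^{-1}\delta\Big(\frac{\alpha x_2+x_0}{x_1}\Big)Y_W\big(Y(R_{\psi(\alpha)}u,\alpha^{-1}x_0)v,x_2\big),$$ as formal series in $x_1^{\pm1},x_2^{\pm1}$ with coefficients in $\mathrm{End}\,W$;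 the sum is finite: for given $u,v$ only finitely many $\alpha$ contribute a nonzero series. -/

import Mathlib

/-! Formal calculus.  A series `∑ c(m,n) x₁^m x₂^n` (all integer exponents allowed) with coefficients
in a module `M` is a function `ℤ → ℤ → M`; a series in `x₀, x₁, x₂` is a function `ℤ → ℤ → ℤ → M`,
the three arguments being the exponents of `x₀`, `x₁`, `x₂` in this order. -/

namespace FormalCalculus

noncomputable section

/-- The coefficient of `x^i y^j` in `(a x + b y)^n` (`n` any integer), expanded in nonnegative
powers of the second variable `y`, that is, in `∑_{j ≥ 0} binom(n,j) a^(n-j) b^j x^(n-j) y^j`. -/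
def binomCoeff (a b : ℂ) (n i j : ℤ) : ℂ :=
  if 0 ≤ j ∧ i + j = n then ((Ring.choose n j.toNat : ℤ) : ℂ) * a ^ i * b ^ j.toNat else 0

/-- The coefficient of `x^i y^j z^k` in
`z⁻¹ δ((a x + b y) / (c z)) = ∑_{n ∈ ℤ} c^(-n) (a x + b y)^n z^(-n-1)`;
only `n = -k-1` contributes. -/
def deltaCoeff (a b c : ℂ) (i j k : ℤ) : ℂ :=
  c ^ (k + 1) * binomCoeff a b (-k - 1) i j

/-- The series `x₀⁻¹ δ((x₁ - x₂) / x₀)`. -/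
def deltaLeft : ℤ → ℤ → ℤ → ℂ := fun e₀ e₁ e₂ => deltaCoeff 1 (-1) 1 e₁ e₂ e₀

/-- The series `x₀⁻¹ δ((x₂ - x₁) / (-x₀))`. -/
def deltaMid : ℤ → ℤ → ℤ → ℂ := fun e₀ e₁ e₂ => deltaCoeff 1 (-1) (-1) e₂ e₁ e₀

/-- The series `x₂⁻¹ δ((x₁ - x₀) / x₂)`. -/
def deltaRight : ℤ → ℤ → ℤ → ℂ := fun e₀ e₁ e₂ => deltaCoeff 1 (-1) 1 e₁ e₀ e₂

/-- The series `x₁⁻¹ δ((α x₂ + x₀) / x₁)`. -/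
def deltaShift (α : ℂ) : ℤ → ℤ → ℤ → ℂ := fun e₀ e₁ e₂ => deltaCoeff α 1 1 e₂ e₀ e₁

variable {M : Type*} [AddCommGroup M] [Module ℂ M]

/-- The product of a scalar series and an `M`-valued series in `x₀, x₁, x₂`.  It is only used where
each coefficient is a finite sum. -/
def mulSeries (D : ℤ → ℤ → ℤ → ℂ) (F : ℤ → ℤ → ℤ → M) : ℤ → ℤ → ℤ → M :=
  fun e₀ e₁ e₂ => ∑ᶠ d : ℤ × ℤ × ℤ, D d.1 d.2.1 d.2.2 • F (e₀ - d.1) (e₁ - d.2.1) (e₂ - d.2.2)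

/-- The product `p(x₁,x₂) F(x₁,x₂)` of a polynomial and a series; the variables `0` and `1` of `p`
are `x₁` and `x₂`. -/
def polyMul (p : MvPolynomial (Fin 2) ℂ) (F : ℤ → ℤ → M) : ℤ → ℤ → M :=
  fun e₁ e₂ => ∑ s ∈ p.support, p.coeff s • F (e₁ - (s 0 : ℤ)) (e₂ - (s 1 : ℤ))

/-- The substitution `F(x) ↦ F(a x)` (in the first variable, when there are several). -/
def scaleVar (a : ℂˣ) (F : ℤ → M) : ℤ → M := fun n => (a : ℂ) ^ n • F n

/-- A series in `x₁, x₂` viewed as a series in `x₀, x₁, x₂`. -/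
def constX₀ (F : ℤ → ℤ → M) : ℤ → ℤ → ℤ → M :=
  fun e₀ e₁ e₂ => if e₀ = 0 then F e₁ e₂ else 0

/-- The residue in `x₀`: the coefficient of `x₀⁻¹`. -/
def resX₀ (F : ℤ → ℤ → ℤ → M) : ℤ → ℤ → M := F (-1)

variable {V W : Type*} [AddCommGroup V] [Module ℂ V] [AddCommGroup W] [Module ℂ W]

/-- `A(x₁) B(x₂)` for `A, B ∈ Hom(W, W((x)))`, as a series with coefficients in `End W`. -/
def prod₁₂ (A B : VertexOperator ℂ W) : ℤ → ℤ → Module.End ℂ W :=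
  fun e₁ e₂ => HVertexOperator.coeff A e₁ * HVertexOperator.coeff B e₂

/-- `B(x₂) A(x₁)`, as a series in `x₁, x₂` with coefficients in `End W`. -/
def prod₂₁ (A B : VertexOperator ℂ W) : ℤ → ℤ → Module.End ℂ W :=
  fun e₁ e₂ => HVertexOperator.coeff B e₂ * HVertexOperator.coeff A e₁

/-- The commutator `[A(x₁), B(x₂)]`. -/
def commutator (A B : VertexOperator ℂ W) : ℤ → ℤ → Module.End ℂ W :=
  prod₁₂ A B - prod₂₁ A B

/-- The series `Y_W(Y(u,x₀)v, x₂)` in `x₀, x₁, x₂` with coefficients in `End W`. -/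
def iterate (Y : V →ₗ[ℂ] VertexOperator ℂ V) (YW : V →ₗ[ℂ] VertexOperator ℂ W) (u v : V) :
    ℤ → ℤ → ℤ → Module.End ℂ W :=
  fun e₀ e₁ e₂ =>
    if e₁ = 0 then HVertexOperator.coeff (YW (HVertexOperator.coeff (Y u) e₀ v)) e₂ else 0

/-- The Jacobi identity for `u, v` multiplied by the polynomial `p(x₁,x₂)`:
`x₀⁻¹δ((x₁-x₂)/x₀) p Y_W(u,x₁)Y_W(v,x₂) - x₀⁻¹δ((x₂-x₁)/(-x₀)) p Y_W(v,x₂)Y_W(u,x₁)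
  = x₂⁻¹δ((x₁-x₀)/x₂) p Y_W(Y(u,x₀)v,x₂)`.
Both sides are applied to an arbitrary vector `w`, as the coefficients of these products are sums
that become finite only then. -/
def QuasiJacobi (Y : V →ₗ[ℂ] VertexOperator ℂ V) (YW : V →ₗ[ℂ] VertexOperator ℂ W)
    (p : MvPolynomial (Fin 2) ℂ) (u v : V) : Prop :=
  ∀ w : W,
    mulSeries deltaLeft (constX₀ fun e₁ e₂ => polyMul p (prod₁₂ (YW u) (YW v)) e₁ e₂ w)
      - mulSeries deltaMid (constX₀ fun e₁ e₂ => polyMul p (prod₂₁ (YW u) (YW v)) e₁ e₂ w)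
    = mulSeries deltaRight (fun e₀ e₁ e₂ => polyMul p (iterate Y YW u v e₀) e₁ e₂ w)

end

end FormalCalculus

/-- A vertex algebra structure on a complex vector space `V`.  The type `VertexOperator ℂ V` is
`Hom(V, V((x)))`. -/
structure VertexAlgebra (V : Type*) [AddCommGroup V] [Module ℂ V] where
  /-- The vacuum vector. -/
  vac : V
  /-- The vertex operator map `v ↦ Y(v,x)`. -/
  Y : V →ₗ[ℂ] VertexOperator ℂ V
  /-- `Y(𝟏,x) = 1`. -/
  Y_vac : ∀ n : ℤ, HVertexOperator.coeff (Y vac) n = if n = 0 then LinearMap.id else 0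
  /-- `Y(v,x)𝟏` has no negative powers of `x`. -/
  creation_neg : ∀ (v : V) (n : ℤ), n < 0 → HVertexOperator.coeff (Y v) n vac = 0
  /-- The constant term of `Y(v,x)𝟏` is `v`. -/
  creation_zero : ∀ v : V, HVertexOperator.coeff (Y v) 0 vac = v
  /-- The Jacobi identity. -/
  jacobi : ∀ u v : V, FormalCalculus.QuasiJacobi Y Y 1 u v

/-- A quasimodule `(W, Y_W)` for a vertex algebra. -/
structure VertexAlgebra.Quasimodule {V : Type*} [AddCommGroup V] [Module ℂ V]
    (A : VertexAlgebra V) (W : Type*) [AddCommGroup W] [Module ℂ W] where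
  /-- The vertex operator map `v ↦ Y_W(v,x)`. -/
  YW : V →ₗ[ℂ] VertexOperator ℂ W
  /-- `Y_W(𝟏,x) = 1`. -/
  YW_vac : ∀ n : ℤ, HVertexOperator.coeff (YW A.vac) n = if n = 0 then LinearMap.id else 0
  /-- The quasi-Jacobi identity. -/
  quasiJacobi : ∀ u v : V, ∃ p : MvPolynomial (Fin 2) ℂ, p ≠ 0 ∧
    FormalCalculus.QuasiJacobi A.Y YW p u v

/-- A `Γ`-vertex algebra structure on `V`. -/
structure GammaVertexAlgebra (Γ : Type*) [Group Γ] (V : Type*) [AddCommGroup V] [Module ℂ V]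
    extends VertexAlgebra V where
  /-- The action of `Γ` by linear automorphisms. -/
  R : Γ →* (V ≃ₗ[ℂ] V)
  /-- The character of `Γ`. -/
  φ : Γ →* ℂˣ
  /-- `R_g 𝟏 = 𝟏`. -/
  R_vac : ∀ g : Γ, R g vac = vac
  /-- `R_g Y(v,x) R_g⁻¹ = Y(R_g v, φ(g)⁻¹ x)`. -/
  R_conj : ∀ (g : Γ) (v : V),
    (fun n : ℤ => (R g).toLinearMap ∘ₗ HVertexOperator.coeff (Y v) n ∘ₗ (R g).symm.toLinearMap) =
      FormalCalculus.scaleVar (φ g)⁻¹ (HVertexOperator.coeff (Y (R g v)))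

/-- A quasimodule for a `Γ`-vertex algebra. -/
structure GammaVertexAlgebra.Quasimodule {Γ : Type*} [Group Γ] {V : Type*} [AddCommGroup V]
    [Module ℂ V] (A : GammaVertexAlgebra Γ V) (W : Type*) [AddCommGroup W] [Module ℂ W]
    extends VertexAlgebra.Quasimodule A.toVertexAlgebra W where
  /-- `Y_W(R_g v, x) = Y_W(v, φ(g) x)`. -/
  YW_R : ∀ (g : Γ) (v : V),
    HVertexOperator.coeff (YW (A.R g v)) =
      FormalCalculus.scaleVar (A.φ g) (HVertexOperator.coeff (YW v))
  /-- `(x₁ - α₁x₂) ⋯ (x₁ - α_k x₂) [Y_W(u,x₁), Y_W(v,x₂)] = 0` for some `α_i ∈ φ(Γ)`. -/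
  gammaLocal : ∀ u v : V, ∃ (k : ℕ) (α : Fin k → A.φ.range),
    FormalCalculus.polyMul
      (∏ i, (MvPolynomial.X 0 - MvPolynomial.C (((α i : ℂˣ)) : ℂ) * MvPolynomial.X 1))
      (FormalCalculus.commutator (YW u) (YW v)) = 0

/-- For `α ∈ ℂˣ` and `a, v ∈ V`, the series
`Res_{x₀} x₁⁻¹ δ((α x₂ + x₀)/x₁) Y_W(Y(a, α⁻¹ x₀) v, x₂)` with coefficients in `End W`. -/
noncomputable def VertexAlgebra.Quasimodule.commutatorTerm {V : Type*} [AddCommGroup V] [Module ℂ V]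
    {A : VertexAlgebra V} {W : Type*} [AddCommGroup W] [Module ℂ W] (M : A.Quasimodule W)
    (α : ℂˣ) (a v : V) : ℤ → ℤ → Module.End ℂ W :=
  FormalCalculus.resX₀
    (FormalCalculus.mulSeries (FormalCalculus.deltaShift α)
      (FormalCalculus.scaleVar α⁻¹ (FormalCalculus.iterate A.Y M.YW a v)))

/-! Fix `w : W` and regard `[Y_W(u,x₁), Y_W(v,x₂)] w` as a bilateral series in `x₁` with
coefficients in `W((x₂))`. Such series form a module over `K[x₁]` with `K = ℂ((x₂))` a field, so
coprimality arguments apply. By Γ-locality the commutator is killed by a product of factors `x₁ -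
αᵢx₂`, hence is the sum of its primary parts at the roots `αx₂`. The claim is that the part at `αx₂`
is the term indexed by `α`.

Put `a = R_{ψ(α)}u`, so that `Y_W(a,x) = Y_W(u,αx)`; rescaling `x₁` by `α⁻¹` moves the root `x₂` to
`αx₂`. All three delta functions of the Jacobi identity satisfy `(x₁ - x₂)D = x₀D`. Two consequences
follow. First, powers of `x₁ - x₂` lower the `x₀`-exponent of the iterate side, which vanishes
eventually because `Y(a,x₀)v` is truncated; so the term is `(x₁ - αx₂)`-torsion. Second, every
`x₀`-coefficient of the difference of the two sides is killed by `p` and divisible by all powers of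
`x₁ - x₂`. Dividing by the power occurring in `p` leaves a coefficient killed by a polynomial prime
to `x₁ - x₂`, so the difference has no part at that root.

These facts are `exists_pow_smul_commutatorTerm_eq_zero` and `smul_sub_commutatorTerm_eq_zero`;
`eq_sum_of_primary_parts` assembles them. -/

namespace FormalCalculus

open Polynomial

/-! ### Annihilators and Bézout identities -/

section Coprime

variable {R S N : Type*} [CommRing R] [Ring S] [AddCommGroup N] [Module S N] (ρ : R →+* S)

/-- If `p = x ^ s * p'` kills `z` and `x ^ m * r` kills `x ^ s z`, with `p'` coprime to `x ^ m`, then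
`r` already kills `x ^ s z`. -/
theorem smul_eq_zero_of_pow_mul {x r p' : R} {s m : ℕ} {z : N}
    (hp : ρ (x ^ s * p') • z = 0) (hm : ρ (x ^ m * r) • ρ (x ^ s) • z = 0)
    (hc : IsCoprime (x ^ m) p') : ρ r • ρ (x ^ s) • z = 0 := by
  obtain ⟨a, b, hab⟩ := hc
  have key : r * x ^ s = a * ((x ^ m * r) * x ^ s) + b * r * (x ^ s * p') := by
    linear_combination (-(r * x ^ s)) * hab
  rw [smul_smul, ← map_mul] at hm ⊢
  rw [key, map_add, map_mul ρ a, map_mul ρ (b * r), add_smul, mul_smul, mul_smul, hm, hp]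
  simp

theorem eq_zero_of_isCoprime {p q : R} {z : N} (hp : ρ p • z = 0) (hq : ρ q • z = 0)
    (hc : IsCoprime p q) : z = 0 := by
  obtain ⟨a, b, hab⟩ := hc
  have : ρ (a * p + b * q) • z = 0 := by
    rw [map_add, map_mul, map_mul, add_smul, mul_smul, mul_smul, hp, hq]; simp
  simpa [hab] using this

/-- For pairwise coprime `s j`, the products omitting one factor generate the unit ideal. -/
theorem eq_zero_of_prod_sdiff {ι : Type*} [DecidableEq ι] {t : Finset ι} (ht : t.Nonempty)
    {s : ι → R} (hs : Pairwise (Function.onFun IsCoprime s)) {z : N}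
    (hz : ∀ i ∈ t, ρ (∏ j ∈ t \ {i}, s j) • z = 0) : z = 0 := by
  obtain ⟨μ, hμ⟩ := (exists_sum_eq_one_iff_pairwise_coprime (s := s) ht).2
    fun i j hij => hs (fun h => hij (Subtype.ext h))
  have : ρ (∑ i ∈ t, μ i * ∏ j ∈ t \ {i}, s j) • z = 0 := by
    rw [map_sum, Finset.sum_smul]
    exact Finset.sum_eq_zero fun i hi => by rw [map_mul, mul_smul, hz i hi, smul_zero]
  simpa [hμ] using this

end Coprime

/-! ### Bilateral series as a module over `K[x]` -/

section Shift

variable {K N : Type*} [Field K] [AddCommGroup N] [Module K N]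

/-- Multiplication by `x` on the bilateral series `∑ c(n) xⁿ` with coefficients in `N`. -/
def shift (K N : Type*) [Field K] [AddCommGroup N] [Module K N] : (ℤ → N) →ₗ[K] (ℤ → N) :=
  LinearMap.funLeft K N fun n => n - 1

/-- The substitution `x ↦ b x` on the bilateral series `∑ c(n) xⁿ`. -/
def rescale (b : K) (f : ℤ → N) : ℤ → N := fun n => b ^ n • f n

theorem rescale_zero (b : K) : rescale b (0 : ℤ → N) = 0 := by
  funext n
  simp [rescale]

/-- The action of polynomials on bilateral series. -/
noncomputable def polyAct (K N : Type*) [Field K] [AddCommGroup N] [Module K N] :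
    K[X] →+* Module.End K (ℤ → N) :=
  (aeval (shift K N)).toRingHom

theorem polyAct_monomial_apply (n : ℕ) (c : K) (f : ℤ → N) (e : ℤ) :
    (polyAct K N (C c * X ^ n) • f) e = c • f (e - n) := by
  have h : ∀ (n : ℕ) (f : ℤ → N) (e : ℤ), ((shift K N ^ n) f) e = f (e - n) := by
    intro n
    induction n with
    | zero => intro f e; simp
    | succ k ih =>
      intro f e
      rw [pow_succ, Module.End.mul_apply, ih]
      simp only [shift, LinearMap.funLeft_apply]
      congr 1; push_cast; ring
  simp [polyAct, h, Algebra.algebraMap_eq_smul_one]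

theorem polyAct_X_sub_C_apply (b : K) (f : ℤ → N) (e : ℤ) :
    (polyAct K N (X - C b) • f) e = f (e - 1) - b • f e := by
  have h₁ := polyAct_monomial_apply (N := N) 1 (1 : K) f e
  have h₂ := polyAct_monomial_apply 0 b f e
  simp only [map_one, one_mul, pow_one, one_smul, Nat.cast_one, pow_zero, mul_one, Nat.cast_zero,
    sub_zero] at h₁ h₂
  rw [map_sub, sub_smul, Pi.sub_apply, h₁, h₂]

/-- The substitution `x ↦ bx` is multiplicative, so it carries an annihilator of `f` to one of
`f(bx)`. -/
theorem polyAct_comp_rescale {b : K} (hb : b ≠ 0) (q : K[X]) (f : ℤ → N) :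
    polyAct K N (q.comp (C b * X)) • rescale b f = rescale b (polyAct K N q • f) := by
  induction q using Polynomial.induction_on' with
  | add p q hp hq =>
    rw [add_comp, map_add, map_add, add_smul, add_smul, hp, hq]
    funext e
    simp [rescale]
  | monomial n a =>
    funext e
    rw [← C_mul_X_pow_eq_monomial, mul_comp, C_comp, X_pow_comp, mul_pow, ← mul_assoc, ← C_pow,
      ← C_mul, polyAct_monomial_apply]
    simp only [rescale]
    rw [polyAct_monomial_apply, smul_smul, smul_smul]
    congr 1
    rw [mul_assoc, ← zpow_natCast, ← zpow_add₀ hb]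
    rw [mul_comm]
    congr 2
    ring

theorem comp_C_mul_X_ne_zero {b : K} (hb : b ≠ 0) {q : K[X]} (hq : q ≠ 0) :
    q.comp (C b * X) ≠ 0 := by
  intro h
  apply hq
  have := congrArg (fun r : K[X] => r.comp (C b⁻¹ * X)) h
  simpa [comp_assoc, ← mul_assoc, ← C_mul, hb] using this

theorem polyAct_pow_smul_of_chain {b c : K} {z : ℕ → ℤ → N}
    (hz : ∀ n, polyAct K N (X - C b) • z n = c • z (n + 1)) (n : ℕ) :
    polyAct K N ((X - C b) ^ n) • z 0 = c ^ n • z n := by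
  induction n with
  | zero => simp
  | succ k ih => rw [pow_succ', map_mul, mul_smul, ih, smul_comm, hz, smul_smul, ← pow_succ]

/-- If `p` kills a sequence `z₀, z₁, …` with `(x - b) zₙ₊₁ = c zₙ`, then the `(x - b)`-part of
`z₀` vanishes. -/
theorem polyAct_eq_zero_of_tower {b c : K} (hc : c ≠ 0) {p : K[X]} (hp : p ≠ 0) {z : ℕ → ℤ → N}
    (hpz : ∀ n, polyAct K N p • z n = 0)
    (hz : ∀ n, polyAct K N (X - C b) • z (n + 1) = c • z n)
    {m : ℕ} {r : K[X]} (hr : polyAct K N ((X - C b) ^ m * r) • z 0 = 0) :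
    polyAct K N r • z 0 = 0 := by
  obtain ⟨p', hp', hdvd⟩ := exists_eq_pow_rootMultiplicity_mul_and_not_dvd p hp b
  set s := rootMultiplicity b p
  have hpow : ∀ n, polyAct K N ((X - C b) ^ n) • z n = c ^ n • z 0 := by
    intro n
    induction n with
    | zero => simp
    | succ k ih =>
      rw [pow_succ, map_mul, mul_smul, hz, smul_comm, ih, smul_smul, pow_succ']
  have hcop : IsCoprime ((X - C b) ^ m) p' :=
    ((irreducible_X_sub_C b).coprime_iff_not_dvd.2 hdvd).pow_left
  -- Climbing exactly `s` levels absorbs the factor `(x - b)^s` of `p`: up to `c^s`, `z 0` is `(x -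
  -- b)^s • z s`, hence is killed by `p'`.
  have h := smul_eq_zero_of_pow_mul (polyAct K N) (x := X - C b) (r := r) (z := z s)
    (hp' ▸ hpz s) (by rw [hpow, smul_comm, hr, smul_zero]) hcop
  rw [hpow, smul_comm] at h
  exact (smul_eq_zero_iff_right (pow_ne_zero s hc)).1 h

theorem polyAct_smul_eq_zero_of_dvd {p q : K[X]} (h : p ∣ q) {z : ℤ → N}
    (hz : polyAct K N p • z = 0) : polyAct K N q • z = 0 := by
  obtain ⟨r, rfl⟩ := h
  rw [mul_comm, map_mul, mul_smul, hz, smul_zero]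

/-- A series `c` killed by `∏ i, (x - b (α i))` is the sum of its primary parts `d i`. -/
theorem eq_sum_of_primary_parts {ι : Type*} [DecidableEq ι] {b : ι → K}
    (hb : Function.Injective b) {k : ℕ} {α : Fin k → ι} {c : ℤ → N} {d : ι → ℤ → N} {m : ι → ℕ}
    (hc : polyAct K N (∏ i, (X - C (b (α i)))) • c = 0)
    (hm : ∀ i, polyAct K N ((X - C (b i)) ^ m i) • d i = 0)
    (key : ∀ (i : ι) (n : ℕ) (r : K[X]), polyAct K N ((X - C (b i)) ^ n * r) • (c - d i) = 0 →
      polyAct K N r • (c - d i) = 0) :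
    (∀ i ∉ Finset.univ.image α, d i = 0) ∧ c = ∑ i ∈ Finset.univ.image α, d i := by
  have hcop : Pairwise (Function.onFun IsCoprime fun i => X - C (b i)) :=
    pairwise_coprime_X_sub_C hb
  set S := Finset.univ.image α with hS
  have hQ : ∀ n ≥ k, polyAct K N (∏ i ∈ S, (X - C (b i)) ^ n) • c = 0 := fun n hn => by
    -- The `α i` may repeat; each multiplicity is at most `k`.
    rw [Finset.prod_comp (fun i => X - C (b i)) α] at hc
    refine polyAct_smul_eq_zero_of_dvd (Finset.prod_dvd_prod_of_dvd _ _ fun i _ => ?_) hc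
    exact pow_dvd_pow _ ((Finset.card_le_univ _).trans (by simpa using hn))
  constructor
  · intro i hi
    have hQk := hQ k le_rfl
    have h₁ := key i (m i) (∏ j ∈ S, (X - C (b j)) ^ k) (by
      rw [smul_sub, polyAct_smul_eq_zero_of_dvd (dvd_mul_left _ _) hQk,
        polyAct_smul_eq_zero_of_dvd (dvd_mul_right _ _) (hm i), sub_zero])
    rw [smul_sub, hQk, zero_sub, neg_eq_zero] at h₁
    refine eq_zero_of_isCoprime _ (hm i) h₁ (IsCoprime.prod_right fun j hj => ?_)
    exact (hcop fun h => hi (by rwa [h])).pow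
  -- One exponent that is at least `k` and at least every `m i` with `i ∈ S`.
  · set n := k + ∑ i ∈ S, m i
    have hQn := hQ n (Nat.le_add_right _ _)
    have hmn : ∀ i ∈ S, polyAct K N ((X - C (b i)) ^ n) • d i = 0 := fun i hi =>
      polyAct_smul_eq_zero_of_dvd (pow_dvd_pow _ <|
        (Finset.single_le_sum (fun _ _ => Nat.zero_le _) hi).trans (Nat.le_add_left _ _)) (hm i)
    rcases S.eq_empty_or_nonempty with hE | hne
    · simpa [hE] using hQn
    rw [← sub_eq_zero]
    refine eq_zero_of_prod_sdiff (polyAct K N) hne (s := fun i => (X - C (b i)) ^ n)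
      (fun i j h => (hcop h).pow) fun i hi => ?_
    have hprod : (X - C (b i)) ^ n * ∏ j ∈ S \ {i}, (X - C (b j)) ^ n =
        ∏ j ∈ S, (X - C (b j)) ^ n :=
      (Finset.prod_eq_mul_prod_sdiff_singleton_of_mem hi _).symm
    have h₁ := key i n (∏ j ∈ S \ {i}, (X - C (b j)) ^ n) (by
      rw [smul_sub, polyAct_smul_eq_zero_of_dvd (dvd_mul_right _ _) (hmn i hi), hprod, hQn,
        sub_zero])
    have h₂ : ∀ j ∈ S \ {i}, polyAct K N (∏ j ∈ S \ {i}, (X - C (b j)) ^ n) • d j = 0 :=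
      fun j hj => polyAct_smul_eq_zero_of_dvd
        (Finset.dvd_prod_of_mem (fun j => (X - C (b j)) ^ n) hj) (hmn j (Finset.mem_sdiff.1 hj).1)
    rw [Finset.sum_eq_add_sum_sdiff_singleton_of_mem hi, ← sub_sub, smul_sub, h₁, Finset.smul_sum,
      Finset.sum_eq_zero h₂, sub_zero]

end Shift

end FormalCalculus

/-! ### Coefficients of the delta functions -/

namespace FormalCalculus

section Delta

theorem support_of_binomCoeff_ne_zero {a b : ℂ} {n i j : ℤ} (h : binomCoeff a b n i j ≠ 0) :
    0 ≤ j ∧ i + j = n := by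
  by_contra hc
  exact h (if_neg hc)

theorem support_of_deltaCoeff_ne_zero {a b c : ℂ} {i j k : ℤ} (h : deltaCoeff a b c i j k ≠ 0) :
    0 ≤ j ∧ i + j = -k - 1 :=
  support_of_binomCoeff_ne_zero (right_ne_zero_of_mul h)

/-- `(a x + b y)^(n+1) = (a x + b y) (a x + b y)^n`, coefficientwise. -/
theorem binomCoeff_add_one {a : ℂ} (ha : a ≠ 0) (b : ℂ) (n i j : ℤ) :
    binomCoeff a b (n + 1) i j = a * binomCoeff a b n (i - 1) j + b * binomCoeff a b n i (j - 1) := by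
  unfold binomCoeff
  by_cases hij : i + j = n + 1
  swap
  · rw [if_neg (by omega), if_neg (by omega), if_neg (by omega)]; simp
  rcases lt_trichotomy j 0 with hj | hj | hj
  · rw [if_neg (by omega), if_neg (by omega), if_neg (by omega)]; simp
  · subst hj
    rw [if_pos (by omega), if_pos (by omega), if_neg (by omega)]
    simp only [Int.toNat_zero, Ring.choose_zero_right, pow_zero, Int.cast_one, mul_zero, add_zero,
      one_mul, mul_one]
    rw [← zpow_one_add₀ ha]; congr 1; ring
  · rw [if_pos (by omega), if_pos (by omega), if_pos (by omega)]
    obtain ⟨k, rfl⟩ : ∃ k : ℕ, j = k + 1 := ⟨(j - 1).toNat, by omega⟩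
    rw [show ((k : ℤ) + 1).toNat = k + 1 by omega, show ((k : ℤ) + 1 - 1).toNat = k by omega,
      Ring.choose_succ_succ]
    have : a ^ i = a * a ^ (i - 1) := by rw [← zpow_one_add₀ ha]; congr 1; ring
    rw [this]
    push_cast
    ring

/-- This is `(ax + by) δ = cz δ`. In each of the three Jacobi delta functions it becomes `(x₁ - x₂)D
= x₀D`. -/
theorem deltaCoeff_sub_one {a c : ℂ} (ha : a ≠ 0) (hc : c ≠ 0) (b : ℂ) (i j k : ℤ) :
    c * deltaCoeff a b c i j (k - 1) =
      a * deltaCoeff a b c (i - 1) j k + b * deltaCoeff a b c i (j - 1) k := by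
  unfold deltaCoeff
  rw [show -(k - 1) - 1 = (-k - 1) + 1 by ring, binomCoeff_add_one ha, zpow_add_one₀ hc k,
    sub_add_cancel]
  ring

theorem deltaLeft_recurrence (i j k : ℤ) :
    deltaLeft i (j - 1) k - deltaLeft i j (k - 1) = deltaLeft (i - 1) j k := by
  have := deltaCoeff_sub_one (a := 1) (c := 1) one_ne_zero one_ne_zero (-1) j k i
  simp only [deltaLeft]
  linear_combination -this

theorem deltaMid_recurrence (i j k : ℤ) :
    deltaMid i (j - 1) k - deltaMid i j (k - 1) = deltaMid (i - 1) j k := by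
  have := deltaCoeff_sub_one (a := 1) (c := -1) one_ne_zero (by norm_num) (-1) k j i
  simp only [deltaMid]
  linear_combination this

theorem deltaRight_recurrence (i j k : ℤ) :
    deltaRight i (j - 1) k - deltaRight i j (k - 1) = deltaRight (i - 1) j k := by
  have := deltaCoeff_sub_one (a := 1) (c := 1) one_ne_zero one_ne_zero (-1) j i k
  simp only [deltaRight]
  linear_combination -this

theorem deltaCoeff_neg_one (a b c : ℂ) (i j : ℤ) :
    deltaCoeff a b c i j (-1) = if i = 0 ∧ j = 0 then 1 else 0 := by
  unfold deltaCoeff binomCoeff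
  by_cases h : i = 0 ∧ j = 0
  · simp [h]
  · rw [if_neg h]
    split_ifs with h'
    · have hj : 0 < j.toNat := by omega
      simp [Ring.choose_zero_pos ℤ hj]
    · simp

/-- A rescaled form of `x₁⁻¹δ((x₂ + x₀)/x₁) = x₂⁻¹δ((x₁ - x₀)/x₂)`, which rests on `binom(-j-1,n) =
(-1)^n binom(j+n,n)`. The factor `α^(1+i)` is what `x₀ ↦ α⁻¹x₀` contributes to the residue, at
exponent `-1-i`. -/
theorem deltaShift_mul_pow (α : ℂˣ) (i j k : ℤ) :
    deltaShift α i j k * (α : ℂ) ^ (1 + i) = (α : ℂ) ^ (-j) * deltaRight i j k := by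
  unfold deltaShift deltaRight deltaCoeff binomCoeff
  by_cases h : 0 ≤ i ∧ i + j + k = -1
  swap
  · rw [if_neg (by omega), if_neg (by omega)]; simp
  obtain ⟨hi, hs⟩ := h
  rw [if_pos (by omega), if_pos (by omega)]
  obtain ⟨n, rfl⟩ : ∃ n : ℕ, i = n := ⟨i.toNat, by omega⟩
  have hc : Ring.choose (-j - 1) n = (-1) ^ n * Ring.choose (-k - 1) n := by
    rw [show -j - 1 = -(j + 1) by ring, Ring.choose_neg, show j + 1 + (n : ℤ) - 1 = -k - 1 by omega]
    simp [Int.negOnePow_def, Units.smul_def]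
  have hp : (α : ℂ) ^ k * (α : ℂ) ^ (1 + (n : ℤ)) = (α : ℂ) ^ (-j) := by
    rw [← zpow_add₀ α.ne_zero]; congr 1; omega
  simp only [Int.toNat_natCast, hc, one_zpow, one_pow, one_mul, mul_one]
  rw [mul_assoc, hp]
  push_cast
  ring

end Delta

/-! ### Products with delta functions: finiteness and truncation -/

section MulSeries

variable {M : Type*} [AddCommGroup M] [Module ℂ M]

/-- Each coefficient of the product `D F` is a finite sum. -/
def Multipliable₃ (D : ℤ → ℤ → ℤ → ℂ) (F : ℤ → ℤ → ℤ → M) : Prop :=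
  ∀ e₀ e₁ e₂, (Function.support fun d : ℤ × ℤ × ℤ =>
    D d.1 d.2.1 d.2.2 • F (e₀ - d.1) (e₁ - d.2.1) (e₂ - d.2.2)).Finite

theorem mulSeries_polyMul {D : ℤ → ℤ → ℤ → ℂ} {F : ℤ → ℤ → ℤ → M} (h : Multipliable₃ D F)
    (p : MvPolynomial (Fin 2) ℂ) (e₀ : ℤ) :
    mulSeries D (fun e₀ => polyMul p (F e₀)) e₀ = polyMul p (mulSeries D F e₀) := by
  funext e₁ e₂
  simp only [mulSeries, polyMul, Finset.smul_sum]
  have hf : ∀ s : Fin 2 →₀ ℕ, (Function.support fun d : ℤ × ℤ × ℤ =>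
      p.coeff s • D d.1 d.2.1 d.2.2 •
        F (e₀ - d.1) (e₁ - (s 0 : ℤ) - d.2.1) (e₂ - (s 1 : ℤ) - d.2.2)).Finite := fun s =>
    (h e₀ (e₁ - (s 0 : ℤ)) (e₂ - (s 1 : ℤ))).subset
      (Function.support_const_smul_subset (p.coeff s) _)
  have hc : ∀ (d : ℤ × ℤ × ℤ) (s : Fin 2 →₀ ℕ),
      D d.1 d.2.1 d.2.2 • p.coeff s •
        F (e₀ - d.1) (e₁ - d.2.1 - (s 0 : ℤ)) (e₂ - d.2.2 - (s 1 : ℤ)) =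
      p.coeff s • D d.1 d.2.1 d.2.2 •
        F (e₀ - d.1) (e₁ - (s 0 : ℤ) - d.2.1) (e₂ - (s 1 : ℤ) - d.2.2) := fun d s => by
    rw [smul_comm, sub_right_comm e₁, sub_right_comm e₂]
  simp only [hc]
  rw [finsum_sum_comm _ _ fun s _ => hf s]
  exact Finset.sum_congr rfl fun s _ => (smul_finsum' _ (h _ _ _)).symm

theorem mulSeries_shift (D : ℤ → ℤ → ℤ → ℂ) (F : ℤ → ℤ → ℤ → M) (a₀ a₁ a₂ e₀ e₁ e₂ : ℤ) :
    mulSeries D F (e₀ - a₀) (e₁ - a₁) (e₂ - a₂) = ∑ᶠ d : ℤ × ℤ × ℤ,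
      D (d.1 - a₀) (d.2.1 - a₁) (d.2.2 - a₂) • F (e₀ - d.1) (e₁ - d.2.1) (e₂ - d.2.2) := by
  unfold mulSeries
  rw [← finsum_comp_equiv (Equiv.addRight ((-a₀, -a₁, -a₂) : ℤ × ℤ × ℤ))]
  refine finsum_congr fun d => ?_
  simp only [Equiv.coe_addRight, Prod.fst_add, Prod.snd_add, ← sub_eq_add_neg]
  congr 2 <;> ring

theorem Multipliable₃.shift {D : ℤ → ℤ → ℤ → ℂ} {F : ℤ → ℤ → ℤ → M} (h : Multipliable₃ D F)
    (a₀ a₁ a₂ e₀ e₁ e₂ : ℤ) : (Function.support fun d : ℤ × ℤ × ℤ =>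
      D (d.1 - a₀) (d.2.1 - a₁) (d.2.2 - a₂) •
        F (e₀ - d.1) (e₁ - d.2.1) (e₂ - d.2.2)).Finite := by
  have := (h (e₀ - a₀) (e₁ - a₁) (e₂ - a₂)).preimage
    (f := Equiv.addRight ((-a₀, -a₁, -a₂) : ℤ × ℤ × ℤ)) (Equiv.injective _).injOn
  refine this.subset fun d hd => ?_
  simpa [← sub_eq_add_neg] using hd

/-- If `(x₁ - x₂) D = x₀ D` then `(x₁ - x₂) (D F) = x₀ (D F)`. -/
theorem mulSeries_recurrence {D : ℤ → ℤ → ℤ → ℂ} {F : ℤ → ℤ → ℤ → M} (h : Multipliable₃ D F)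
    (hD : ∀ i j k, D i (j - 1) k - D i j (k - 1) = D (i - 1) j k) (e₀ e₁ e₂ : ℤ) :
    mulSeries D F e₀ (e₁ - 1) e₂ - mulSeries D F e₀ e₁ (e₂ - 1) = mulSeries D F (e₀ - 1) e₁ e₂ := by
  have h₁ := mulSeries_shift D F 0 1 0 e₀ e₁ e₂
  have h₂ := mulSeries_shift D F 0 0 1 e₀ e₁ e₂
  have h₃ := mulSeries_shift D F 1 0 0 e₀ e₁ e₂
  have f₁ := h.shift 0 1 0 e₀ e₁ e₂
  have f₂ := h.shift 0 0 1 e₀ e₁ e₂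
  simp only [sub_zero] at h₁ h₂ h₃ f₁ f₂
  rw [h₁, h₂, h₃, ← finsum_sub_distrib f₁ f₂]
  simp only [← sub_smul, hD]

theorem mulSeries_eq_zero {D : ℤ → ℤ → ℤ → ℂ} {F : ℤ → ℤ → ℤ → M} {e₀ e₁ e₂ : ℤ}
    (h : ∀ i j k, D i j k ≠ 0 → F (e₀ - i) (e₁ - j) (e₂ - k) = 0) :
    mulSeries D F e₀ e₁ e₂ = 0 := by
  refine finsum_eq_zero_of_forall_eq_zero fun d => ?_
  by_cases hd : D d.1 d.2.1 d.2.2 = 0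
  · rw [hd, zero_smul]
  · rw [h _ _ _ hd, smul_zero]

theorem polyMul_constX₀ (p : MvPolynomial (Fin 2) ℂ) (G : ℤ → ℤ → M) (e₀ : ℤ) :
    polyMul p (constX₀ G e₀) = constX₀ (polyMul p G) e₀ := by
  funext e₁ e₂
  unfold polyMul constX₀
  split_ifs <;> simp

/-- For each power of `x₁`, the powers of `x₂` in `f` are bounded below. -/
def RowBounded {M : Type*} [AddCommGroup M] (f : ℤ → ℤ → M) : Prop := ∀ e₁, ∃ N, ∀ e₂ < N, f e₁ e₂ = 0

theorem RowBounded.sub {M : Type*} [AddCommGroup M] {f g : ℤ → ℤ → M} (hf : RowBounded f) (hg : RowBounded g) :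
    RowBounded (f - g) := fun e₁ => by
  obtain ⟨a, ha⟩ := hf e₁
  obtain ⟨b, hb⟩ := hg e₁
  exact ⟨min a b, fun e₂ h => by
    simp [ha e₂ (h.trans_le (min_le_left _ _)), hb e₂ (h.trans_le (min_le_right _ _))]⟩

theorem exists_forall_lt_of_rows {P : ℤ → ℤ → Prop} (hP : ∀ i, ∃ N, ∀ n < N, P i n) (a b c : ℤ) :
    ∃ N, ∀ n < N, ∀ i, a ≤ i → i ≤ b → ∀ m ≤ n + c, P i m := by
  choose B hB using hP
  obtain ⟨L, hL⟩ := ((Finset.Icc a b).image B).bddBelow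
  refine ⟨L - c, fun n hn i ha hb m hm => hB i m ?_⟩
  have := hL (Finset.mem_image_of_mem B (Finset.mem_Icc.2 ⟨ha, hb⟩))
  omega

theorem multipliable_deltaLeft {G : ℤ → ℤ → M} {N : ℤ}
    (hG : ∀ e₁, ∀ e₂ < N, G e₁ e₂ = 0) :
    Multipliable₃ deltaLeft (constX₀ G) := fun e₀ e₁ e₂ => by
  refine ((Set.finite_Icc 0 (e₂ - N)).image fun j => (e₀, -e₀ - 1 - j, j)).subset fun d hd => ?_
  obtain ⟨i, j, k⟩ := d
  have h₁ := support_of_deltaCoeff_ne_zero (left_ne_zero_of_smul hd)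
  have h₂ := right_ne_zero_of_smul hd
  simp only [constX₀, ne_eq, ite_eq_right_iff, not_forall] at h₁ h₂
  obtain ⟨h₃, h₄⟩ := h₂
  have h₅ : N ≤ e₂ - k := not_lt.1 fun h => h₄ (hG _ _ h)
  exact ⟨k, Set.mem_Icc.2 (by omega), by ext <;> simp <;> omega⟩

theorem rowBounded_deltaLeft {G : ℤ → ℤ → M} {N : ℤ}
    (hG : ∀ e₁, ∀ e₂ < N, G e₁ e₂ = 0) (e₀ : ℤ) :
    RowBounded (mulSeries deltaLeft (constX₀ G) e₀) :=
  fun e₁ => ⟨N, fun e₂ h => mulSeries_eq_zero fun i j k hD => by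
    have := (support_of_deltaCoeff_ne_zero hD).1
    simp [constX₀, hG (e₁ - j) (e₂ - k) (by omega)]⟩

theorem multipliable_deltaMid {G : ℤ → ℤ → M} {N : ℤ}
    (hG : ∀ e₁ < N, ∀ e₂, G e₁ e₂ = 0) :
    Multipliable₃ deltaMid (constX₀ G) := fun e₀ e₁ e₂ => by
  refine ((Set.finite_Icc 0 (e₁ - N)).image fun j => (e₀, j, -e₀ - 1 - j)).subset fun d hd => ?_
  obtain ⟨i, j, k⟩ := d
  have h₁ := support_of_deltaCoeff_ne_zero (left_ne_zero_of_smul hd)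
  have h₂ := right_ne_zero_of_smul hd
  simp only [constX₀, ne_eq, ite_eq_right_iff, not_forall] at h₁ h₂
  obtain ⟨h₃, h₄⟩ := h₂
  have h₅ : N ≤ e₁ - j := not_lt.1 fun h => h₄ (hG _ h _)
  exact ⟨j, Set.mem_Icc.2 (by omega), by ext <;> simp <;> omega⟩

theorem rowBounded_deltaMid {G : ℤ → ℤ → M} {N : ℤ}
    (hG : ∀ e₁ < N, ∀ e₂, G e₁ e₂ = 0) (hr : RowBounded G) (e₀ : ℤ) :
    RowBounded (mulSeries deltaMid (constX₀ G) e₀) := fun e₁ => by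
  -- Only the rows `e₁ - j` of `G` with `0 ≤ j ≤ e₁ - N` matter; there the `x₂`-exponent is `e₂ + e₀
  -- + 1 + j`.
  obtain ⟨L, hL⟩ := exists_forall_lt_of_rows hr N e₁ (e₀ + 1 + (e₁ - N))
  refine ⟨L, fun e₂ h => mulSeries_eq_zero fun i j k hD => ?_⟩
  have h₁ := support_of_deltaCoeff_ne_zero hD
  unfold constX₀
  split_ifs with h₂
  · by_cases h₃ : e₁ - j < N
    · exact hG _ h₃ _
    · exact hL e₂ h _ (by omega) (by omega) _ (by omega)
  · rfl

/-- A series in `x₀, x₂` viewed as a series in `x₀, x₁, x₂`. -/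
def constX₁ (H : ℤ → ℤ → M) : ℤ → ℤ → ℤ → M :=
  fun e₀ e₁ e₂ => if e₁ = 0 then H e₀ e₂ else 0

theorem multipliable_deltaRight {H : ℤ → ℤ → M} {N : ℤ}
    (hH : ∀ e₀ < N, ∀ e₂, H e₀ e₂ = 0) :
    Multipliable₃ deltaRight (constX₁ H) := fun e₀ e₁ e₂ => by
  refine ((Set.finite_Icc 0 (e₀ - N)).image fun j => (j, e₁, -1 - j - e₁)).subset fun d hd => ?_
  obtain ⟨i, j, k⟩ := d
  have h₁ := support_of_deltaCoeff_ne_zero (left_ne_zero_of_smul hd)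
  have h₂ := right_ne_zero_of_smul hd
  simp only [constX₁, ne_eq, ite_eq_right_iff, not_forall] at h₁ h₂
  obtain ⟨h₃, h₄⟩ := h₂
  have h₅ : N ≤ e₀ - i := not_lt.1 fun h => h₄ (hH _ h _)
  exact ⟨i, Set.mem_Icc.2 (by omega), by ext <;> simp <;> omega⟩

theorem rowBounded_deltaRight {H : ℤ → ℤ → M} {N : ℤ}
    (hH : ∀ e₀ < N, ∀ e₂, H e₀ e₂ = 0) (hr : RowBounded H) (e₀ : ℤ) :
    RowBounded (mulSeries deltaRight (constX₁ H) e₀) := fun e₁ => by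
  obtain ⟨L, hL⟩ := exists_forall_lt_of_rows hr N e₀ (1 + e₁ + (e₀ - N))
  refine ⟨L, fun e₂ h => mulSeries_eq_zero fun i j k hD => ?_⟩
  have h₁ := support_of_deltaCoeff_ne_zero hD
  unfold constX₁
  split_ifs with h₂
  · by_cases h₃ : e₀ - i < N
    · exact hH _ h₃ _
    · exact hL e₂ h _ (by omega) (by omega) _ (by omega)
  · rfl

theorem mulSeries_deltaRight_eq_zero {H : ℤ → ℤ → M} {N : ℤ}
    (hH : ∀ e₀ < N, ∀ e₂, H e₀ e₂ = 0) {e₀ : ℤ} (he : e₀ < N) :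
    mulSeries deltaRight (constX₁ H) e₀ = 0 := by
  funext e₁ e₂
  refine mulSeries_eq_zero fun i j k hD => ?_
  have h₁ := support_of_deltaCoeff_ne_zero hD
  simp [constX₁, hH (e₀ - i) (by omega)]

/-- Taking the residue of the Jacobi identity thus turns its left side into the commutator. -/
theorem mulSeries_constX₀_neg_one {D : ℤ → ℤ → ℤ → ℂ}
    (hD : ∀ j k, D (-1) j k = if j = 0 ∧ k = 0 then 1 else 0) (G : ℤ → ℤ → M) :
    mulSeries D (constX₀ G) (-1) = G := by
  funext e₁ e₂
  unfold mulSeries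
  rw [finsum_eq_single _ ((-1, 0, 0) : ℤ × ℤ × ℤ)]
  · simp [hD, constX₀]
  · rintro ⟨i, j, k⟩ h
    by_cases hi : i = -1
    · subst hi
      rw [hD, if_neg (by rintro ⟨rfl, rfl⟩; exact h rfl), zero_smul]
    · simp only [constX₀]
      rw [if_neg (by omega), smul_zero]

end MulSeries

end FormalCalculus

/-! ### Passage to series in `x₁` over `ℂ((x₂))` -/

namespace FormalCalculus

open Polynomial

section Series

variable {W : Type*} [AddCommGroup W] [Module ℂ W]

/-- The coefficients of a bilateral series in `x₁` with coefficients in `W((x₂))`. -/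
noncomputable def seriesCoeff (f : ℤ → HahnModule ℤ ℂ W) : ℤ → ℤ → W :=
  fun e₁ e₂ => ((HahnModule.of ℂ).symm (f e₁)).coeff e₂

theorem seriesCoeff_injective :
    Function.Injective (seriesCoeff : (ℤ → HahnModule ℤ ℂ W) → ℤ → ℤ → W) := fun f g h => by
  funext e
  exact HahnModule.ext _ _ (congrFun h e)

theorem seriesCoeff_zero : seriesCoeff (0 : ℤ → HahnModule ℤ ℂ W) = 0 := rfl

theorem seriesCoeff_sub (f g : ℤ → HahnModule ℤ ℂ W) :
    seriesCoeff (f - g) = seriesCoeff f - seriesCoeff g := rfl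

/-- The series in `ℂ((x₂))`-module form with prescribed coefficients. -/
theorem exists_seriesCoeff_eq {f : ℤ → ℤ → W} (hf : RowBounded f) :
    ∃ F : ℤ → HahnModule ℤ ℂ W, seriesCoeff F = f := by
  choose N hN using hf
  exact ⟨fun e => HahnModule.of ℂ (HahnSeries.ofSuppBddBelow (f e)
    ⟨N e, fun n hn => not_lt.1 fun h => hn (hN e n h)⟩), rfl⟩

theorem seriesCoeff_single_smul (c : ℂ) (n : ℤ) (F : HahnModule ℤ ℂ W) (e : ℤ) :
    ((HahnModule.of ℂ).symm ((HahnSeries.single n c : HahnSeries ℤ ℂ) • F)).coeff e =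
      c • ((HahnModule.of ℂ).symm F).coeff (e - n) := by
  have := HahnModule.coeff_single_smul_vadd (r := c) (x := F) (a := e - n) (b := n)
  simpa using this

/-- The polynomial `p(x₁, x₂)` as a polynomial in `x₁` over `ℂ((x₂))`. -/
noncomputable def polyInX₁ : MvPolynomial (Fin 2) ℂ →+* (HahnSeries ℤ ℂ)[X] :=
  MvPolynomial.eval₂Hom (C.comp (HahnSeries.C : ℂ →+* HahnSeries ℤ ℂ))
    ![X, C (HahnSeries.single 1 1)]

theorem polyInX₁_eq_sum (p : MvPolynomial (Fin 2) ℂ) :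
    polyInX₁ p = ∑ s ∈ p.support,
      C (HahnSeries.single (s 1 : ℤ) (p.coeff s)) * X ^ (s 0) := by
  rw [polyInX₁, MvPolynomial.coe_eval₂Hom, MvPolynomial.eval₂_eq']
  refine Finset.sum_congr rfl fun s _ => ?_
  rw [Fin.prod_univ_two]
  simp only [Matrix.cons_val_zero, Matrix.cons_val_one, RingHom.comp_apply]
  rw [mul_comm (X ^ _), ← mul_assoc, ← C_pow, ← C_mul, HahnSeries.single_pow]
  simp [HahnSeries.C_apply, HahnSeries.single_mul_single]

theorem polyInX₁_ne_zero {p : MvPolynomial (Fin 2) ℂ} (hp : p ≠ 0) : polyInX₁ p ≠ 0 := by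
  obtain ⟨s, hs⟩ := MvPolynomial.ne_zero_iff.1 hp
  intro h
  apply hs
  have := congrArg (fun q : (HahnSeries ℤ ℂ)[X] => (q.coeff (s 0)).coeff (s 1 : ℤ)) h
  simp only [polyInX₁_eq_sum, finsetSum_coeff, coeff_C_mul, coeff_X_pow, coeff_zero,
    HahnSeries.coeff_zero, HahnSeries.coeff_sum] at this
  rw [Finset.sum_eq_single s] at this
  · simpa using this
  · intro t _ hts
    by_cases h0 : s 0 = t 0
    · have h1 : s 1 ≠ t 1 := fun h1 => hts (by ext i; fin_cases i <;> simp [h0, h1])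
      simp [h0, HahnSeries.coeff_single_of_ne (show (s 1 : ℤ) ≠ t 1 by exact_mod_cast h1)]
    · simp [h0]
  · intro hn
    simp [MvPolynomial.notMem_support_iff.1 hn]

theorem polyInX₁_X_sub (α : ℂ) :
    polyInX₁ (MvPolynomial.X 0 - MvPolynomial.C α * MvPolynomial.X 1) =
      X - C (HahnSeries.single 1 α) := by
  simp [polyInX₁, HahnSeries.C_apply, ← C_mul, HahnSeries.single_mul_single]

theorem seriesCoeff_polyAct (p : MvPolynomial (Fin 2) ℂ) (F : ℤ → HahnModule ℤ ℂ W) :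
    seriesCoeff (polyAct (HahnSeries ℤ ℂ) (HahnModule ℤ ℂ W) (polyInX₁ p) • F) = polyMul p (seriesCoeff F) := by
  funext e₁ e₂
  rw [polyInX₁_eq_sum, map_sum, Finset.sum_smul]
  simp only [seriesCoeff, polyMul, Finset.sum_apply, polyAct_monomial_apply]
  have : ∀ (t : Finset (Fin 2 →₀ ℕ)) (g : (Fin 2 →₀ ℕ) → HahnModule ℤ ℂ W),
      ((HahnModule.of ℂ).symm (∑ s ∈ t, g s)).coeff e₂ =
        ∑ s ∈ t, ((HahnModule.of ℂ).symm (g s)).coeff e₂ := fun t g =>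
    map_sum (⟨⟨fun x => ((HahnModule.of ℂ).symm x).coeff e₂, rfl⟩, fun _ _ => rfl⟩ :
      HahnModule ℤ ℂ W →+ W) g t
  rw [this]
  simp only [seriesCoeff_single_smul]

theorem polyAct_polyInX₁_eq_zero_iff {p : MvPolynomial (Fin 2) ℂ} {F : ℤ → HahnModule ℤ ℂ W} :
    polyAct (HahnSeries ℤ ℂ) (HahnModule ℤ ℂ W) (polyInX₁ p) • F = 0 ↔ polyMul p (seriesCoeff F) = 0 := by
  rw [← seriesCoeff_polyAct, ← seriesCoeff_zero, seriesCoeff_injective.eq_iff]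

theorem seriesCoeff_X_sub_C_smul (α : ℂ) (F : ℤ → HahnModule ℤ ℂ W) (e₁ e₂ : ℤ) :
    seriesCoeff (polyAct (HahnSeries ℤ ℂ) (HahnModule ℤ ℂ W) (X - C (HahnSeries.single 1 α)) • F) e₁ e₂ =
      seriesCoeff F (e₁ - 1) e₂ - α • seriesCoeff F e₁ (e₂ - 1) := by
  simp only [seriesCoeff, polyAct_X_sub_C_apply, ← seriesCoeff_single_smul]
  rfl

theorem seriesCoeff_rescale (a : ℂˣ) (F : ℤ → HahnModule ℤ ℂ W) (e₁ e₂ : ℤ) :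
    seriesCoeff (rescale (HahnSeries.C (a : ℂ) : HahnSeries ℤ ℂ) F) e₁ e₂ =
      (a : ℂ) ^ e₁ • seriesCoeff F e₁ e₂ := by
  simp only [seriesCoeff, rescale]
  rw [← map_zpow₀, HahnSeries.C_apply, seriesCoeff_single_smul, sub_zero]

theorem polyMul_apply (p : MvPolynomial (Fin 2) ℂ) (F : ℤ → ℤ → Module.End ℂ W) (w : W)
    (e₁ e₂ : ℤ) : polyMul p F e₁ e₂ w = polyMul p (fun e₁ e₂ => F e₁ e₂ w) e₁ e₂ := by
  simp [polyMul, LinearMap.sum_apply]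

theorem exists_coeff_eq_zero (A : VertexOperator ℂ W) (w : W) :
    ∃ N, ∀ n < N, HVertexOperator.coeff A n w = 0 :=
  ⟨_, fun n hn => VertexOperator.coeff_eq_zero_of_lt_order A n w hn⟩

end Series

end FormalCalculus

/-! ### The defect of the Jacobi identity -/

namespace FormalCalculus

open Polynomial

section Defect

variable {V W : Type*} [AddCommGroup V] [Module ℂ V] [AddCommGroup W] [Module ℂ W]
  (Y : V →ₗ[ℂ] VertexOperator ℂ V) (YW : V →ₗ[ℂ] VertexOperator ℂ W) (u v : V) (w : W)

/-- The series `Y_W(Y(u,x₀)v, x₂) w`. -/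
def iterateOn : ℤ → ℤ → W :=
  fun e₀ e₂ => HVertexOperator.coeff (YW (HVertexOperator.coeff (Y u) e₀ v)) e₂ w

/-- The series `x₂⁻¹ δ((x₁ - x₀)/x₂) Y_W(Y(u,x₀)v, x₂) w`. -/
noncomputable def iterateSide : ℤ → ℤ → ℤ → W :=
  mulSeries deltaRight (constX₁ (iterateOn Y YW u v w))

/-- The difference of the two sides of the Jacobi identity for `u, v`, applied to `w`. -/
noncomputable def jacobiDefect : ℤ → ℤ → ℤ → W :=
  mulSeries deltaLeft (constX₀ fun e₁ e₂ => prod₁₂ (YW u) (YW v) e₁ e₂ w)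
    - mulSeries deltaMid (constX₀ fun e₁ e₂ => prod₂₁ (YW u) (YW v) e₁ e₂ w)
    - iterateSide Y YW u v w

theorem prod₁₂_truncated (A B : VertexOperator ℂ W) (w : W) :
    ∃ N, ∀ e₁, ∀ e₂ < N, prod₁₂ A B e₁ e₂ w = 0 := by
  obtain ⟨N, hN⟩ := exists_coeff_eq_zero B w
  exact ⟨N, fun e₁ e₂ h => by rw [prod₁₂, Module.End.mul_apply, hN _ h, map_zero]⟩

theorem prod₂₁_truncated (A B : VertexOperator ℂ W) (w : W) :
    ∃ N, ∀ e₁ < N, ∀ e₂, prod₂₁ A B e₁ e₂ w = 0 := by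
  obtain ⟨N, hN⟩ := exists_coeff_eq_zero A w
  exact ⟨N, fun e₁ h e₂ => by rw [prod₂₁, Module.End.mul_apply, hN _ h, map_zero]⟩

theorem rowBounded_prod₂₁ (A B : VertexOperator ℂ W) (w : W) :
    RowBounded fun e₁ e₂ => prod₂₁ A B e₁ e₂ w := fun _ =>
  exists_coeff_eq_zero B _

theorem rowBounded_commutator (A B : VertexOperator ℂ W) (w : W) :
    RowBounded fun e₁ e₂ => commutator A B e₁ e₂ w := by
  obtain ⟨N, hN⟩ := prod₁₂_truncated A B w
  exact RowBounded.sub (f := fun e₁ e₂ => prod₁₂ A B e₁ e₂ w) (fun e₁ => ⟨N, hN e₁⟩)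
    (rowBounded_prod₂₁ A B w)

theorem iterateOn_truncated : ∃ N, ∀ e₀ < N, ∀ e₂, iterateOn Y YW u v w e₀ e₂ = 0 := by
  obtain ⟨N, hN⟩ := exists_coeff_eq_zero (Y u) v
  exact ⟨N, fun e₀ h e₂ => by rw [iterateOn, hN _ h, map_zero, map_zero]; rfl⟩

theorem rowBounded_iterateOn : RowBounded (iterateOn Y YW u v w) := fun _ =>
  exists_coeff_eq_zero _ w

theorem rowBounded_iterateSide (e₀ : ℤ) : RowBounded (iterateSide Y YW u v w e₀) := by
  obtain ⟨N, hN⟩ := iterateOn_truncated Y YW u v w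
  exact rowBounded_deltaRight hN (rowBounded_iterateOn Y YW u v w) e₀

theorem rowBounded_jacobiDefect (e₀ : ℤ) : RowBounded (jacobiDefect Y YW u v w e₀) := by
  obtain ⟨N, hN⟩ := prod₁₂_truncated (YW u) (YW v) w
  obtain ⟨N', hN'⟩ := prod₂₁_truncated (YW u) (YW v) w
  exact ((rowBounded_deltaLeft hN e₀).sub
    (rowBounded_deltaMid hN' (rowBounded_prod₂₁ _ _ w) e₀)).sub
      (rowBounded_iterateSide Y YW u v w e₀)

theorem iterateSide_recurrence (e₀ e₁ e₂ : ℤ) :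
    iterateSide Y YW u v w e₀ (e₁ - 1) e₂ - iterateSide Y YW u v w e₀ e₁ (e₂ - 1) =
      iterateSide Y YW u v w (e₀ - 1) e₁ e₂ := by
  obtain ⟨N, hN⟩ := iterateOn_truncated Y YW u v w
  exact mulSeries_recurrence (multipliable_deltaRight hN) deltaRight_recurrence e₀ e₁ e₂

theorem jacobiDefect_recurrence (e₀ e₁ e₂ : ℤ) :
    jacobiDefect Y YW u v w e₀ (e₁ - 1) e₂ - jacobiDefect Y YW u v w e₀ e₁ (e₂ - 1) =
      jacobiDefect Y YW u v w (e₀ - 1) e₁ e₂ := by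
  obtain ⟨N, hN⟩ := prod₁₂_truncated (YW u) (YW v) w
  obtain ⟨N', hN'⟩ := prod₂₁_truncated (YW u) (YW v) w
  simp only [jacobiDefect, Pi.sub_apply,
    ← mulSeries_recurrence (multipliable_deltaLeft hN) deltaLeft_recurrence,
    ← mulSeries_recurrence (multipliable_deltaMid hN') deltaMid_recurrence,
    ← iterateSide_recurrence]
  abel

theorem polyMul_sub (p : MvPolynomial (Fin 2) ℂ) (f g : ℤ → ℤ → W) :
    polyMul p (f - g) = polyMul p f - polyMul p g := by
  funext e₁ e₂
  simp [polyMul, smul_sub]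

theorem iterate_apply (e₀ : ℤ) :
    (fun e₁ e₂ => iterate Y YW u v e₀ e₁ e₂ w) = constX₁ (iterateOn Y YW u v w) e₀ := by
  funext e₁ e₂
  unfold iterate constX₁
  split_ifs <;> rfl

/-- As `p` does not involve `x₀`, it can be pulled out of each delta product one `x₀`-coefficient at
a time. -/
theorem polyMul_jacobiDefect {p : MvPolynomial (Fin 2) ℂ} (h : QuasiJacobi Y YW p u v) (e₀ : ℤ) :
    polyMul p (jacobiDefect Y YW u v w e₀) = 0 := by
  obtain ⟨N, hN⟩ := prod₁₂_truncated (YW u) (YW v) w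
  obtain ⟨N', hN'⟩ := prod₂₁_truncated (YW u) (YW v) w
  obtain ⟨N₂, hN₂⟩ := iterateOn_truncated Y YW u v w
  have hw := congrFun (h w) e₀
  simp only [polyMul_apply, iterate_apply, Pi.sub_apply] at hw
  rw [mulSeries_polyMul (multipliable_deltaRight hN₂),
    show (fun e₁ e₂ => polyMul p (fun e₁ e₂ => prod₁₂ (YW u) (YW v) e₁ e₂ w) e₁ e₂) =
      polyMul p (fun e₁ e₂ => prod₁₂ (YW u) (YW v) e₁ e₂ w) from rfl,
    show (fun e₁ e₂ => polyMul p (fun e₁ e₂ => prod₂₁ (YW u) (YW v) e₁ e₂ w) e₁ e₂) =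
      polyMul p (fun e₁ e₂ => prod₂₁ (YW u) (YW v) e₁ e₂ w) from rfl,
    show constX₀ (polyMul p fun e₁ e₂ => prod₁₂ (YW u) (YW v) e₁ e₂ w) = _ from
      funext fun e => (polyMul_constX₀ p _ e).symm,
    show constX₀ (polyMul p fun e₁ e₂ => prod₂₁ (YW u) (YW v) e₁ e₂ w) = _ from
      funext fun e => (polyMul_constX₀ p _ e).symm,
    mulSeries_polyMul (multipliable_deltaLeft hN),
    mulSeries_polyMul (multipliable_deltaMid hN')] at hw
  rw [jacobiDefect, Pi.sub_apply, Pi.sub_apply, polyMul_sub, polyMul_sub, hw]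
  exact sub_self _

theorem jacobiDefect_neg_one (e₁ e₂ : ℤ) :
    jacobiDefect Y YW u v w (-1) e₁ e₂ =
      commutator (YW u) (YW v) e₁ e₂ w - iterateSide Y YW u v w (-1) e₁ e₂ := by
  simp only [jacobiDefect, Pi.sub_apply]
  rw [mulSeries_constX₀_neg_one (D := deltaLeft) (fun j k => deltaCoeff_neg_one _ _ _ _ _),
    mulSeries_constX₀_neg_one (D := deltaMid) (fun j k => (deltaCoeff_neg_one _ _ _ _ _).trans
      (if_congr and_comm rfl rfl))]
  rfl

end Defect

end FormalCalculus

/-! ### The primary part of the commutator at `αx₂` -/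

namespace VertexAlgebra.Quasimodule

open FormalCalculus Polynomial

variable {V : Type*} [AddCommGroup V] [Module ℂ V] {A : VertexAlgebra V} {W : Type*}
  [AddCommGroup W] [Module ℂ W] (M : A.Quasimodule W)

theorem commutatorTerm_eq_smul (α : ℂˣ) (a v : V) (e₁ e₂ : ℤ) :
    M.commutatorTerm α a v e₁ e₂ =
      (α : ℂ) ^ (-e₁) • mulSeries deltaRight (iterate A.Y M.YW a v) (-1) e₁ e₂ := by
  unfold commutatorTerm resX₀ mulSeries
  rw [smul_finsum]
  refine finsum_congr fun d => ?_
  simp only [scaleVar, Pi.smul_apply, smul_smul]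
  by_cases hd : e₁ - d.2.1 = 0
  · congr 1
    rw [Units.val_inv_eq_inv_val, inv_zpow', show -(-1 - d.1) = 1 + d.1 by ring,
      deltaShift_mul_pow, show e₁ = d.2.1 by omega]
  · simp [iterate, hd]

theorem commutatorTerm_apply (α : ℂˣ) (a v : V) (w : W) (e₁ e₂ : ℤ) :
    M.commutatorTerm α a v e₁ e₂ w =
      (α : ℂ) ^ (-e₁) • iterateSide A.Y M.YW a v w (-1) e₁ e₂ := by
  rw [commutatorTerm_eq_smul, LinearMap.smul_apply]
  congr 1
  obtain ⟨N, hN⟩ := exists_coeff_eq_zero (A.Y a) v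
  -- The truncation of `Y(a,x₀)v` does not depend on `w`, so the sum is already finite in `End W`
  -- and evaluation at `w` passes through it.
  have hfin := multipliable_deltaRight (M := Module.End ℂ W) (N := N)
    (H := fun e₀ e₂ => HVertexOperator.coeff (M.YW (HVertexOperator.coeff (A.Y a) e₀ v)) e₂)
    (fun e₀ h e₂ => by rw [hN _ h, map_zero, map_zero]; rfl) (-1) e₁ e₂
  have := (LinearMap.applyₗ w : Module.End ℂ W →ₗ[ℂ] W).toAddMonoidHom.map_finsum hfin
  refine this.trans (finsum_congr fun d => ?_)
  change (deltaRight d.1 d.2.1 d.2.2 • iterate A.Y M.YW a v _ _ _) w = _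
  rw [LinearMap.smul_apply, ← iterate_apply]

theorem rowBounded_commutatorTerm (α : ℂˣ) (a v : V) (w : W) :
    RowBounded fun e₁ e₂ => M.commutatorTerm α a v e₁ e₂ w := fun e₁ => by
  obtain ⟨N, hN⟩ := rowBounded_iterateSide A.Y M.YW a v w (-1) e₁
  exact ⟨N, fun e₂ h => by simp only [commutatorTerm_apply, hN e₂ h, smul_zero]⟩

/-- Because `x₁ - αx₂ = α(α⁻¹x₁ - x₂)`. -/
theorem smul_rescale_of_recurrence {α : ℂˣ} {f g : ℤ → HahnModule ℤ ℂ W}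
    (h : ∀ e₁ e₂, seriesCoeff f (e₁ - 1) e₂ - seriesCoeff f e₁ (e₂ - 1) = seriesCoeff g e₁ e₂) :
    polyAct (HahnSeries ℤ ℂ) (HahnModule ℤ ℂ W) (X - C (HahnSeries.single 1 (α : ℂ))) •
        rescale (HahnSeries.C ((α⁻¹ : ℂˣ) : ℂ) : HahnSeries ℤ ℂ) f =
      (HahnSeries.single 0 (α : ℂ) : HahnSeries ℤ ℂ) •
        rescale (HahnSeries.C ((α⁻¹ : ℂˣ) : ℂ) : HahnSeries ℤ ℂ) g := by
  refine seriesCoeff_injective (funext fun e₁ => funext fun e₂ => ?_)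
  have hs : ∀ F : ℤ → HahnModule ℤ ℂ W,
      seriesCoeff ((HahnSeries.single 0 (α : ℂ) : HahnSeries ℤ ℂ) • F) e₁ e₂ =
        (α : ℂ) • seriesCoeff F e₁ e₂ := fun F => by
    simp only [seriesCoeff, Pi.smul_apply]
    rw [seriesCoeff_single_smul, sub_zero]
  rw [hs, seriesCoeff_X_sub_C_smul, seriesCoeff_rescale, seriesCoeff_rescale, seriesCoeff_rescale,
    ← h, smul_sub, smul_sub, zpow_sub_one₀ (Units.ne_zero _)]
  congr 1
  rw [smul_smul, mul_comm]
  simp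

/-- The series `commutatorTerm α a v w` is annihilated by a power of `x₁ - α x₂`. -/
theorem exists_pow_smul_commutatorTerm_eq_zero (α : ℂˣ) (a v : V) (w : W)
    {d : ℤ → HahnModule ℤ ℂ W} (hd : seriesCoeff d = fun e₁ e₂ => M.commutatorTerm α a v e₁ e₂ w) :
    ∃ m, polyAct (HahnSeries ℤ ℂ) (HahnModule ℤ ℂ W)
      ((X - C (HahnSeries.single 1 (α : ℂ))) ^ m) • d = 0 := by
  choose y hy using fun n : ℕ =>
    exists_seriesCoeff_eq (rowBounded_iterateSide A.Y M.YW a v w (-1 - n))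
  have hd0 : d = rescale (HahnSeries.C ((α⁻¹ : ℂˣ) : ℂ) : HahnSeries ℤ ℂ) (y 0) := by
    refine seriesCoeff_injective (funext fun e₁ => funext fun e₂ => ?_)
    rw [seriesCoeff_rescale, hd, hy]
    simp [commutatorTerm_apply]
  have hpow := polyAct_pow_smul_of_chain (b := (HahnSeries.single 1 (α : ℂ) : HahnSeries ℤ ℂ))
    (c := HahnSeries.single 0 (α : ℂ))
    (z := fun n => rescale (HahnSeries.C ((α⁻¹ : ℂˣ) : ℂ) : HahnSeries ℤ ℂ) (y n)) fun n =>
      smul_rescale_of_recurrence fun e₁ e₂ => by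
        rw [hy, hy, iterateSide_recurrence]
        congr 1
        push_cast
        ring
  obtain ⟨N, hN⟩ := iterateOn_truncated A.Y M.YW a v w
  -- This makes the `x₀`-exponent `-1 - m` less than `N`, whatever the sign of `N`.
  refine ⟨(-N).toNat, ?_⟩
  have hy0 : y (-N).toNat = 0 := by
    refine seriesCoeff_injective ?_
    rw [hy, iterateSide, mulSeries_deltaRight_eq_zero hN (by omega)]
    rfl
  rw [hd0, hpow, hy0, rescale_zero, smul_zero]

/-- The `(x₁ - α x₂)`-part of the commutator `[Y_W(u,x₁), Y_W(v,x₂)]` is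
`commutatorTerm α a v` as soon as `Y_W(a,x) = Y_W(u,αx)`. -/
theorem smul_sub_commutatorTerm_eq_zero (α : ℂˣ) {u a : V} (v : V) (w : W)
    (ha : HVertexOperator.coeff (M.YW a) = scaleVar α (HVertexOperator.coeff (M.YW u)))
    {c d : ℤ → HahnModule ℤ ℂ W}
    (hc : seriesCoeff c = fun e₁ e₂ => FormalCalculus.commutator (M.YW u) (M.YW v) e₁ e₂ w)
    (hd : seriesCoeff d = fun e₁ e₂ => M.commutatorTerm α a v e₁ e₂ w)
    {m : ℕ} {r : (HahnSeries ℤ ℂ)[X]}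
    (hr : polyAct (HahnSeries ℤ ℂ) (HahnModule ℤ ℂ W)
      ((X - C (HahnSeries.single 1 (α : ℂ))) ^ m * r) • (c - d) = 0) :
    polyAct (HahnSeries ℤ ℂ) (HahnModule ℤ ℂ W) r • (c - d) = 0 := by
  -- The exponents increase from `-1`: each coefficient is `x₁ - x₂` times the next one, which gives
  -- the divisibility.
  choose y hy using fun n : ℕ =>
    exists_seriesCoeff_eq (rowBounded_jacobiDefect A.Y M.YW a v w (-1 + n))
  have h0 : c - d = rescale (HahnSeries.C ((α⁻¹ : ℂˣ) : ℂ) : HahnSeries ℤ ℂ) (y 0) := by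
    refine seriesCoeff_injective (funext fun e₁ => funext fun e₂ => ?_)
    have hcomm : FormalCalculus.commutator (M.YW a) (M.YW v) e₁ e₂ w =
        (α : ℂ) ^ e₁ • FormalCalculus.commutator (M.YW u) (M.YW v) e₁ e₂ w := by
      simp only [FormalCalculus.commutator, prod₁₂, prod₂₁, ha, scaleVar, Pi.sub_apply,
        LinearMap.sub_apply, Module.End.mul_apply, LinearMap.smul_apply, map_smul, smul_sub]
    rw [seriesCoeff_rescale, seriesCoeff_sub, Pi.sub_apply, Pi.sub_apply, hc, hd, hy,
      Nat.cast_zero, add_zero, jacobiDefect_neg_one, hcomm, smul_sub, smul_smul,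
      Units.val_inv_eq_inv_val, inv_zpow, inv_mul_cancel₀ (zpow_ne_zero _ α.ne_zero), one_smul]
    simp [commutatorTerm_apply]
  obtain ⟨p, hp, hJ⟩ := M.quasiJacobi a v
  have hb : (HahnSeries.C ((α⁻¹ : ℂˣ) : ℂ) : HahnSeries ℤ ℂ) ≠ 0 := by simp
  have hα : (HahnSeries.single 0 (α : ℂ) : HahnSeries ℤ ℂ) ≠ 0 := by simp
  rw [h0] at hr ⊢
  refine polyAct_eq_zero_of_tower (z := fun n => rescale (HahnSeries.C ((α⁻¹ : ℂˣ) : ℂ) : HahnSeries ℤ ℂ) (y n))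
    hα (comp_C_mul_X_ne_zero hb (polyInX₁_ne_zero hp)) (fun n => ?_) (fun n => ?_) hr
  · rw [polyAct_comp_rescale hb, polyAct_polyInX₁_eq_zero_iff.2 (by
      rw [hy, polyMul_jacobiDefect A.Y M.YW a v w hJ]), rescale_zero]
  · refine smul_rescale_of_recurrence fun e₁ e₂ => ?_
    rw [hy, hy, jacobiDefect_recurrence]
    congr 1
    push_cast
    ring

end VertexAlgebra.Quasimodule

/-! ### Assembling the commutator formula -/

namespace GammaVertexAlgebra.Quasimodule

open FormalCalculus Polynomial

variable {Γ : Type*} [Group Γ] {V : Type*} [AddCommGroup V] [Module ℂ V] {W : Type*}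
  [AddCommGroup W] [Module ℂ W] {A : GammaVertexAlgebra Γ V}

theorem exists_finset_commutator_eq_sum (M : GammaVertexAlgebra.Quasimodule A W)
    (ψ : A.φ.range → Γ) (hψ : ∀ α : A.φ.range, A.φ (ψ α) = (α : ℂˣ)) (u v : V) :
    ∃ S : Finset A.φ.range,
      (∀ α ∉ S, M.commutatorTerm (α : ℂˣ) (A.R (ψ α) u) v = 0) ∧
      FormalCalculus.commutator (M.YW u) (M.YW v) =
        ∑ α ∈ S, M.commutatorTerm (α : ℂˣ) (A.R (ψ α) u) v := by
  classical
  obtain ⟨k, β, hβ⟩ := M.gammaLocal u v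
  have ha : ∀ α : A.φ.range, HVertexOperator.coeff (M.YW (A.R (ψ α) u)) =
      scaleVar (α : ℂˣ) (HVertexOperator.coeff (M.YW u)) := fun α => by
    rw [M.YW_R, hψ]
  choose c hc using fun w => exists_seriesCoeff_eq (rowBounded_commutator (M.YW u) (M.YW v) w)
  choose d hd using fun (α : A.φ.range) w =>
    exists_seriesCoeff_eq (M.rowBounded_commutatorTerm (α : ℂˣ) (A.R (ψ α) u) v w)
  choose m hm using fun (α : A.φ.range) w =>
    M.exists_pow_smul_commutatorTerm_eq_zero (α : ℂˣ) (A.R (ψ α) u) v w (hd α w)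
  have hkill : ∀ w, polyAct (HahnSeries ℤ ℂ) (HahnModule ℤ ℂ W)
      (∏ i, (X - C (HahnSeries.single 1 ((β i : ℂˣ) : ℂ)))) • c w = 0 := fun w => by
    have := (polyAct_polyInX₁_eq_zero_iff (F := c w)
      (p := ∏ i, (MvPolynomial.X 0 - MvPolynomial.C (((β i : ℂˣ)) : ℂ) * MvPolynomial.X 1))).2 (by
        funext e₁ e₂
        rw [hc, ← polyMul_apply, hβ]
        rfl)
    simp only [map_prod, polyInX₁_X_sub] at this
    exact this
  have hinj : Function.Injective fun α : A.φ.range =>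
      (HahnSeries.single 1 ((α : ℂˣ) : ℂ) : HahnSeries ℤ ℂ) := fun α α' h =>
    Subtype.ext (Units.ext (HahnSeries.single_injective 1 h))
  have hparts := fun w => eq_sum_of_primary_parts hinj (d := fun α => d α w) (hkill w)
    (fun α => hm α w) fun α _ _ h =>
      M.smul_sub_commutatorTerm_eq_zero (α : ℂˣ) v w (ha α) (hc w) (hd α w) h
  -- The roots `β` come from the locality of `u, v` alone, so one finite set serves every `w`.
  refine ⟨Finset.univ.image β, fun α hα => ?_, ?_⟩
  · funext e₁ e₂
    ext w
    have := congrFun (congrFun (hd α w) e₁) e₂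
    rw [(hparts w).1 α hα] at this
    exact this.symm
  · funext e₁ e₂
    ext w
    have h₁ := congrFun (congrFun (hc w) e₁) e₂
    have h₂ : seriesCoeff (∑ α ∈ Finset.univ.image β, d α w) =
        ∑ α ∈ Finset.univ.image β, seriesCoeff (d α w) :=
      map_sum (⟨⟨seriesCoeff, rfl⟩, fun _ _ => rfl⟩ :
        (ℤ → HahnModule ℤ ℂ W) →+ (ℤ → ℤ → W)) (fun α => d α w) _
    rw [(hparts w).2, h₂] at h₁
    simp only [Finset.sum_apply, LinearMap.sum_apply, hd] at h₁ ⊢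
    exact h₁.symm

end GammaVertexAlgebra.Quasimodule

theorem proposition2p13 {Γ : Type*} [Group Γ] {V : Type*} [AddCommGroup V] [Module ℂ V]
    {W : Type*} [AddCommGroup W] [Module ℂ W]
    (A : GammaVertexAlgebra Γ V) (M : GammaVertexAlgebra.Quasimodule A W)
    (ψ : A.φ.range → Γ) (hψ : ∀ α : A.φ.range, A.φ (ψ α) = (α : ℂˣ))
    (u v : V) :
    {α : A.φ.range | M.commutatorTerm (α : ℂˣ) (A.R (ψ α) u) v ≠ 0}.Finite ∧
    FormalCalculus.commutator (M.YW u) (M.YW v) =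
      ∑ᶠ α : A.φ.range, M.commutatorTerm (α : ℂˣ) (A.R (ψ α) u) v := by
  obtain ⟨S, h₀, hS⟩ := M.exists_finset_commutator_eq_sum ψ hψ u v
  have hsub : Function.support (fun α : A.φ.range =>
      M.commutatorTerm (α : ℂˣ) (A.R (ψ α) u) v) ⊆ S := fun α hα => by
    by_contra h
    exact hα (h₀ α h)
  exact ⟨S.finite_toSet.subset hsub, by rw [hS, finsum_eq_sum_of_support_subset _ hsub]⟩
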